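/- **Definitions.** Let $(X,d)$ be a separable metric space. It has *negative type* if for all $m\ge 1$ and all $x_1,\dots,x_m,x'_1,\dots,x'_m\in X$, $$\sum_{i,j=1}^m\bigl(d(x_i,x_j)+d(x'_i,x'_j)\bigr)\;\le\;2\sum_{i,j=1}^m d(x_i,x'_j).$$ Let $P_1(X,d)$ be the set of Borel probability measures $\mu$ on $X$ with finite first moment, i.e. $\int d(o,x)\,d\mu(x)<\infty$ for some $o\in X$. For $\mu_1,\mu_2\in P_1(X,d)$ let $(\mu_1-\mu_2)^2$ denote the product of the signed measure $\mu_1-\mu_2$ with itself on $X\times X$. The space $(X,d)$ has *strong negative type* if it has negative type and, for $\mu_1,\mu_2\in P_1(X,d)$, the equality $\int d(x_1,x_2)\,d(\mu_1-\mu_2)^2(x_1,x_2)=0$ holds only when $\mu_1=\mu_2$. Let $\mathbb H^n_{\mathbb R}$ be real hyperbolic space of dimension $n$, i.e. the hyperboloid $\{(t,x)\in\mathbb R\times\mathbb R^n: t>0,\ t^2-\|x\|^2=1\}$ with the metric $d$ determined by $\cosh d\bigl((t,x),(t',x')\bigr)=tt'-\langle x,x'\rangle$. **Theorem.** For every $n\ge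 1$, real hyperbolic space $\mathbb H^n_{\mathbb R}$ has strong negative type. Concretely, for all $\mu_1,\mu_2\in P_1(\mathbb H^n_{\mathbb R},d)$, the distance is integrable with respect to $(\mu_1-\mu_2)^2$ and $$\int d(x_1,x_2)\,d(\mu_1-\mu_2)^2(x_1,x_2)\le 0,$$ with equality only if $\mu_1=\mu_2$. Moreover, the map $\mu\mapsto a_\mu$, where $a_\mu(x)=\int d(x,x')\,d\mu(x')$ for $x\in\mathbb H^n_{\mathbb R}$, is injective on $P_1(\mathbb H^n_{\mathbb R},d)$. -/

import Mathlib

open MeasureTheory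

noncomputable section

/-- Real hyperbolic space of dimension `n` (curvature `-1`), as the upper sheet of the hyperboloid
`t ^ 2 - ‖x‖ ^ 2 = 1`, `t > 0`, in Minkowski space `ℝ × ℝⁿ`. -/
@[ext]
structure HyperbolicSpace (n : ℕ) where
  time : ℝ
  space : EuclideanSpace ℝ (Fin n)
  time_pos : 0 < time
  time_sq_sub : time ^ 2 - ‖space‖ ^ 2 = 1

namespace HyperbolicSpace

variable {n : ℕ}

/-- The Minkowski product `t t' - ⟪x, x'⟫` of two points of the hyperboloid. -/
def lorentz (p q : HyperbolicSpace n) : ℝ :=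
  p.time * q.time - inner ℝ p.space q.space

/-- The hyperbolic distance: `cosh d(p, q) = t t' - ⟪x, x'⟫`. -/
instance : Dist (HyperbolicSpace n) := ⟨fun p q => Real.arcosh (lorentz p q)⟩

theorem dist_def (p q : HyperbolicSpace n) : dist p q = Real.arcosh (lorentz p q) := rfl

theorem lorentz_comm (p q : HyperbolicSpace n) : lorentz p q = lorentz q p := by
  simp only [lorentz, real_inner_comm, mul_comm]

theorem lorentz_self (p : HyperbolicSpace n) : lorentz p p = 1 := by
  have := p.time_sq_sub
  rw [lorentz, real_inner_self_eq_norm_sq]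
  linarith

/-- The spatial part of `p` after the Lorentz boost that moves `q` to the apex `(1, 0)`. -/
def boost (q p : HyperbolicSpace n) : EuclideanSpace ℝ (Fin n) :=
  p.space - (p.time - inner ℝ p.space q.space / (q.time + 1)) • q.space

theorem inner_boost (q p r : HyperbolicSpace n) :
    inner ℝ (boost q p) (boost q r) = lorentz p q * lorentz r q - lorentz p r := by
  have hq := q.time_sq_sub
  have h1 : q.time + 1 ≠ 0 := by linarith [q.time_pos]
  have hqq : inner ℝ q.space q.space = q.time ^ 2 - 1 := by
    rw [real_inner_self_eq_norm_sq]; linarith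
  simp only [boost, lorentz, inner_sub_left, inner_sub_right, real_inner_smul_left,
    real_inner_smul_right, hqq, real_inner_comm q.space r.space]
  rw [real_inner_comm r.space q.space]
  field_simp
  ring

theorem one_le_lorentz (p q : HyperbolicSpace n) : 1 ≤ lorentz p q := by
  have h := inner_boost q p p
  rw [lorentz_self, real_inner_self_eq_norm_sq] at h
  have hpos : 0 < lorentz p q := by
    have hp := p.time_sq_sub
    have hq := q.time_sq_sub
    have h1 : ‖p.space‖ < p.time := by
      nlinarith [p.time_pos, norm_nonneg p.space]
    have h2 : ‖q.space‖ < q.time := by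
      nlinarith [q.time_pos, norm_nonneg q.space]
    have h3 := real_inner_le_norm p.space q.space
    have h4 := mul_lt_mul'' h1 h2 (norm_nonneg _) (norm_nonneg _)
    rw [lorentz]
    linarith
  nlinarith [sq_nonneg ‖boost q p‖]

theorem sinh_dist (p q : HyperbolicSpace n) : Real.sinh (dist p q) = ‖boost q p‖ := by
  have h := inner_boost q p p
  rw [lorentz_self, real_inner_self_eq_norm_sq] at h
  rw [dist_def, Real.sinh_arcosh (one_le_lorentz p q),
    show lorentz p q ^ 2 - 1 = ‖boost q p‖ ^ 2 by linarith, Real.sqrt_sq (norm_nonneg _)]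

theorem cosh_dist (p q : HyperbolicSpace n) : Real.cosh (dist p q) = lorentz p q :=
  Real.cosh_arcosh (one_le_lorentz p q)

theorem dist_nonneg' (p q : HyperbolicSpace n) : 0 ≤ dist p q :=
  Real.arcosh_nonneg (one_le_lorentz p q)

theorem dist_triangle' (p q r : HyperbolicSpace n) : dist p r ≤ dist p q + dist q r := by
  have hqr : dist q r = dist r q := by rw [dist_def, dist_def, lorentz_comm]
  have h1 := dist_nonneg' p q
  have h2 := dist_nonneg' r q
  rw [hqr, ← abs_of_nonneg (dist_nonneg' p r), ← abs_of_nonneg (add_nonneg h1 h2),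
    ← Real.cosh_le_cosh, Real.cosh_add, cosh_dist, cosh_dist, cosh_dist, sinh_dist, sinh_dist]
  have h3 := neg_le_of_abs_le (abs_real_inner_le_norm (boost q p) (boost q r))
  rw [inner_boost] at h3
  linarith

theorem eq_of_dist_eq_zero' {p q : HyperbolicSpace n} (h : dist p q = 0) : p = q := by
  have hp := p.time_sq_sub
  have hq := q.time_sq_sub
  have h1 : lorentz p q = 1 := by rw [← cosh_dist, h, Real.cosh_zero]
  have h2 : boost q p = 0 := by rw [← norm_eq_zero, ← sinh_dist, h, Real.sinh_zero]
  have hq1 : q.time + 1 ≠ 0 := by linarith [q.time_pos]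
  -- `p` is the point `q` scaled by `c`, and `lorentz p q = 1` forces `c = 1`.
  obtain ⟨c, hc⟩ : ∃ c, p.time - inner ℝ p.space q.space / (q.time + 1) = c := ⟨_, rfl⟩
  have hs : p.space = c • q.space := by
    rw [boost, hc] at h2
    exact sub_eq_zero.mp h2
  have hqq : inner ℝ q.space q.space = q.time ^ 2 - 1 := by
    rw [real_inner_self_eq_norm_sq]; linarith
  have hin : inner ℝ p.space q.space = c * (q.time ^ 2 - 1) := by
    rw [hs, real_inner_smul_left, hqq]
  have ht : p.time = c * q.time := by
    rw [hin] at hc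
    field_simp at hc
    have : (q.time + 1) * (p.time - c * q.time) = 0 := by linarith
    rcases mul_eq_zero.mp this with h | h
    · exact absurd h hq1
    · linarith
  have hc1 : c = 1 := by
    rw [lorentz, hin, ht] at h1
    linarith
  rw [hc1] at hs ht
  ext1
  · rw [ht, one_mul]
  · rw [hs, one_smul]

instance : MetricSpace (HyperbolicSpace n) where
  dist_self p := by rw [dist_def, lorentz_self, Real.arcosh_zero]
  dist_comm p q := by rw [dist_def, dist_def, lorentz_comm]
  dist_triangle := dist_triangle'
  eq_of_dist_eq_zero := eq_of_dist_eq_zero'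

/-- Hyperbolic space carries the Borel `σ`-algebra of its metric topology. -/
instance : MeasurableSpace (HyperbolicSpace n) := borel _

instance : BorelSpace (HyperbolicSpace n) := ⟨rfl⟩

/-- The point of the hyperboloid above a given point of `ℝⁿ`. -/
def ofSpace (x : EuclideanSpace ℝ (Fin n)) : HyperbolicSpace n where
  time := √(1 + ‖x‖ ^ 2)
  space := x
  time_pos := by positivity
  time_sq_sub := by rw [Real.sq_sqrt (by positivity)]; ring

theorem surjective_ofSpace : Function.Surjective (ofSpace (n := n)) := by
  intro p
  refine ⟨p.space, ?_⟩
  ext1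
  · have h := p.time_sq_sub
    change √(1 + ‖p.space‖ ^ 2) = p.time
    rw [show 1 + ‖p.space‖ ^ 2 = p.time ^ 2 by linarith, Real.sqrt_sq p.time_pos.le]
  · rfl

theorem continuous_ofSpace : Continuous (ofSpace (n := n)) := by
  rw [continuous_iff_continuousAt]
  intro x
  rw [ContinuousAt, tendsto_iff_dist_tendsto_zero]
  have h : Continuous fun y => lorentz (ofSpace y) (ofSpace x) := by
    simp only [lorentz, ofSpace]
    fun_prop
  have h2 : Continuous fun y => dist (ofSpace y) (ofSpace x) :=
    Real.continuousOn_arcosh.comp_continuous h fun y => one_le_lorentz _ _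
  simpa using h2.tendsto x

instance : SecondCountableTopology (HyperbolicSpace n) :=
  have : TopologicalSpace.SeparableSpace (HyperbolicSpace n) :=
    surjective_ofSpace.denseRange.separableSpace continuous_ofSpace
  UniformSpace.secondCountable_of_separable _

end HyperbolicSpace

/-- A metric space has negative type if, for all lists of `m ≥ 1` red points `x i` and `m` blue
points `x' i`, the total distance between points of opposite colours is at least the total distance
between points of the same colour, sums being over ordered pairs. -/
def HasNegativeType (X : Type*) [MetricSpace X] : Prop :=
  ∀ m : ℕ, 1 ≤ m → ∀ x x' : Fin m → X,
    ∑ i, ∑ j, (dist (x i) (x j) + dist (x' i) (x' j)) ≤ 2 * ∑ i, ∑ j, dist (x i) (x' j)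

section Measures

variable {X : Type*} [MetricSpace X] [MeasurableSpace X]

variable (X) in
/-- The set `P₁(X, d)` of Borel probability measures on `X` with finite first moment. -/
def finiteFirstMoment : Set (ProbabilityMeasure X) :=
  {μ | ∃ o : X, Integrable (fun x => dist o x) (μ : Measure X)}

/-- The signed measure `(μ₁ - μ₂)²` on `X × X`, the product of `μ₁ - μ₂` with itself. -/
def diffSq (μ₁ μ₂ : ProbabilityMeasure X) : SignedMeasure (X × X) :=
  ((μ₁ : Measure X).toSignedMeasure - (μ₂ : Measure X).toSignedMeasure).prod
    ((μ₁ : Measure X).toSignedMeasure - (μ₂ : Measure X).toSignedMeasure)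
    (ContinuousLinearMap.mul ℝ ℝ)

/-- The integral `∫ d(x₁, x₂) d(μ₁ - μ₂)²(x₁, x₂)`. -/
def distIntegral (μ₁ μ₂ : ProbabilityMeasure X) : ℝ :=
  (diffSq μ₁ μ₂).integral (fun p : X × X => dist p.1 p.2) (ContinuousLinearMap.mul ℝ ℝ)

/-- A (separable) metric space has strong negative type if it has negative type and
`∫ d(x₁, x₂) d(μ₁ - μ₂)²(x₁, x₂) = 0` only when `μ₁ = μ₂`, for `μ₁, μ₂` in `P₁(X, d)`.
Separability makes `d` measurable for the product `σ`-algebra on `X × X`. -/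
def HasStrongNegativeType (X : Type*) [MetricSpace X] [SecondCountableTopology X]
    [MeasurableSpace X] [BorelSpace X] : Prop :=
  HasNegativeType X ∧
    ∀ μ₁ ∈ finiteFirstMoment X, ∀ μ₂ ∈ finiteFirstMoment X,
      distIntegral μ₁ μ₂ = 0 → μ₁ = μ₂

/-- The function `a_μ(x) = ∫ d(x, x') dμ(x')` of expected distances. -/
def expectedDist (μ : ProbabilityMeasure X) (x : X) : ℝ :=
  ∫ x', dist x x' ∂(μ : Measure X)

end Measures

end

/-! In the Klein model `b = x / t` one has `cosh d = t t' (1 - ⟪b, b'⟫)`. Since `arcosh u = log (u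
(1 + √(1 - u⁻²)))`, the distance is `g(p) + g(q)`, with `g = log t + (log 2) / 2`, minus two
positive definite kernels: `-log (1 - ⟪b, b'⟫)` and `-log (1 - z)`, where `z = (1 - √(1 - w)) / 2`
and `w = (cosh d)⁻²` (`dist_eq_sub_sub`). The first part integrates to zero against `(μ - ν)²`
because `μ` and `ν` have equal mass.

Both kernels are limits of polynomials with nonnegative coefficients in Gram kernels, so their
energies are nonnegative. The first is `∑ ⟪b, b'⟫ ^ m / m`; the energy of `⟪b, b'⟫ ^ m` is the sum
of squared differences of the moments of `b` of order `m`. If the energy of `d` vanishes, all these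
moments agree (`kernelEnergy_dist_le`, `kernelEnergy_kleinInner_pow`). As `b` is bounded, the
moments determine its law, and `b` determines the point (`eq_of_integral_prod_klein_eq`). -/

open Filter Topology

/-! ### Energy of a kernel against `(μ - ν)²` -/

section Energy

variable {X : Type*} [MeasurableSpace X]

/-- The integral of the kernel `K` against `(μ - ν)²`, as a combination of four integrals. -/
noncomputable def kernelEnergy (μ ν : Measure X) (K : X × X → ℝ) : ℝ :=
  ∫ p, K p ∂(μ.prod μ) - ∫ p, K p ∂(μ.prod ν) - ∫ p, K p ∂(ν.prod μ) + ∫ p, K p ∂(ν.prod ν)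

/-- Integrability of the kernel `K` against each of the four products of `μ` and `ν`. -/
structure KernelIntegrable (μ ν : Measure X) (K : X × X → ℝ) : Prop where
  left_left : Integrable K (μ.prod μ)
  left_right : Integrable K (μ.prod ν)
  right_left : Integrable K (ν.prod μ)
  right_right : Integrable K (ν.prod ν)

variable {μ ν : Measure X} {K K' : X × X → ℝ}

theorem KernelIntegrable.sub (h : KernelIntegrable μ ν K) (h' : KernelIntegrable μ ν K') :
    KernelIntegrable μ ν fun p => K p - K' p :=
  ⟨h.1.sub h'.1, h.2.sub h'.2, h.3.sub h'.3, h.4.sub h'.4⟩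

theorem KernelIntegrable.mono (h : KernelIntegrable μ ν K) (hm : Measurable K')
    (hle : ∀ p, |K' p| ≤ K p) : KernelIntegrable μ ν K' :=
  ⟨h.1.mono' hm.aestronglyMeasurable (.of_forall hle),
    h.2.mono' hm.aestronglyMeasurable (.of_forall hle),
    h.3.mono' hm.aestronglyMeasurable (.of_forall hle),
    h.4.mono' hm.aestronglyMeasurable (.of_forall hle)⟩

theorem kernelEnergy_sub (h : KernelIntegrable μ ν K) (h' : KernelIntegrable μ ν K') :
    kernelEnergy μ ν (fun p => K p - K' p) = kernelEnergy μ ν K - kernelEnergy μ ν K' := by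
  simp only [kernelEnergy]
  rw [integral_sub h.1 h'.1, integral_sub h.2 h'.2, integral_sub h.3 h'.3, integral_sub h.4 h'.4]
  ring

theorem kernelEnergy_finsetSum {ι : Type*} (s : Finset ι) {F : ι → X × X → ℝ}
    (h : ∀ i ∈ s, KernelIntegrable μ ν (F i)) :
    kernelEnergy μ ν (fun p => ∑ i ∈ s, F i p) = ∑ i ∈ s, kernelEnergy μ ν (F i) := by
  simp only [kernelEnergy]
  rw [integral_finsetSum _ fun i hi => (h i hi).1, integral_finsetSum _ fun i hi => (h i hi).2,
    integral_finsetSum _ fun i hi => (h i hi).3, integral_finsetSum _ fun i hi => (h i hi).4]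
  simp only [Finset.sum_add_distrib, Finset.sum_sub_distrib]

theorem kernelEnergy_div_const (c : ℝ) :
    kernelEnergy μ ν (fun p => K p / c) = kernelEnergy μ ν K / c := by
  simp only [kernelEnergy, integral_div]
  ring

theorem tendsto_kernelEnergy {F : ℕ → X × X → ℝ} {bound : X × X → ℝ}
    (hF : ∀ n, Measurable (F n)) (hb : KernelIntegrable μ ν bound)
    (hle : ∀ n p, |F n p| ≤ bound p) (hlim : ∀ p, Tendsto (fun n => F n p) atTop (𝓝 (K p))) :
    Tendsto (fun n => kernelEnergy μ ν (F n)) atTop (𝓝 (kernelEnergy μ ν K)) := by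
  have key : ∀ ρ : Measure (X × X), Integrable bound ρ →
      Tendsto (fun n => ∫ p, F n p ∂ρ) atTop (𝓝 (∫ p, K p ∂ρ)) := fun ρ hρ =>
    tendsto_integral_of_dominated_convergence bound (fun n => (hF n).aestronglyMeasurable) hρ
      (fun n => .of_forall (hle n)) (.of_forall hlim)
  exact (((key _ hb.1).sub (key _ hb.2)).sub (key _ hb.3)).add (key _ hb.4)

variable [IsFiniteMeasure μ] [IsFiniteMeasure ν]

theorem kernelIntegrable_const (c : ℝ) : KernelIntegrable μ ν fun _ => c :=
  ⟨integrable_const c, integrable_const c, integrable_const c, integrable_const c⟩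

theorem KernelIntegrable.of_bound (hm : Measurable K) {C : ℝ} (hC : ∀ p, |K p| ≤ C) :
    KernelIntegrable μ ν K :=
  (kernelIntegrable_const C).mono hm hC

theorem kernelEnergy_mul_self (f : X → ℝ) :
    kernelEnergy μ ν (fun p => f p.1 * f p.2) = (∫ x, f x ∂μ - ∫ x, f x ∂ν) ^ 2 := by
  simp only [kernelEnergy, integral_prod_mul]
  ring

theorem kernelIntegrable_fst_add_snd {g : X → ℝ} (hμ : Integrable g μ) (hν : Integrable g ν) :
    KernelIntegrable μ ν fun p => g p.1 + g p.2 :=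
  ⟨(hμ.comp_fst μ).add (hμ.comp_snd μ), (hμ.comp_fst ν).add (hν.comp_snd μ),
    (hν.comp_fst μ).add (hμ.comp_snd ν), (hν.comp_fst ν).add (hν.comp_snd ν)⟩

/-- Integrating out the variable that does not occur leaves the total mass of `μ - ν`, which is
zero. -/
theorem kernelEnergy_fst_add_snd {g : X → ℝ} (hμ : Integrable g μ) (hν : Integrable g ν)
    (hmass : μ.real Set.univ = ν.real Set.univ) :
    kernelEnergy μ ν (fun p => g p.1 + g p.2) = 0 := by
  simp only [kernelEnergy]
  rw [integral_add (hμ.comp_fst μ) (hμ.comp_snd μ), integral_add (hμ.comp_fst ν) (hν.comp_snd μ),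
    integral_add (hν.comp_fst μ) (hμ.comp_snd ν), integral_add (hν.comp_fst ν) (hν.comp_snd ν)]
  simp only [integral_fun_fst, integral_fun_snd, smul_eq_mul, hmass]
  ring

theorem kernelEnergy_nonneg_of_tendsto {F : ℕ → X × X → ℝ} {C : ℝ}
    (hF : ∀ n, Measurable (F n)) (hle : ∀ n p, |F n p| ≤ C)
    (hpos : ∀ n, 0 ≤ kernelEnergy μ ν (F n))
    (hlim : ∀ p, Tendsto (fun n => F n p) atTop (𝓝 (K p))) : 0 ≤ kernelEnergy μ ν K :=
  ge_of_tendsto' (tendsto_kernelEnergy hF (kernelIntegrable_const C) hle hlim) hpos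

end Energy

/-! ### Gram kernels of finite rank and their closure properties -/

section FiniteRank

variable {X : Type*} [MeasurableSpace X]

/-- A kernel which is the Gram kernel `⟪Φ x, Φ y⟫` of a bounded measurable map `Φ` to a Euclidean
space of finite dimension. -/
def IsFiniteRankGram (K : X × X → ℝ) : Prop :=
  ∃ (ι : Type) (_ : Fintype ι) (f : ι → X → ℝ), (∀ i, Measurable (f i)) ∧
    (∀ i, ∃ C, ∀ x, |f i x| ≤ C) ∧ ∀ p, K p = ∑ i, f i p.1 * f i p.2

namespace IsFiniteRankGram

variable {K K' : X × X → ℝ}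

theorem mul_self {f : X → ℝ} (hf : Measurable f) {C : ℝ} (hC : ∀ x, |f x| ≤ C) :
    IsFiniteRankGram fun p => f p.1 * f p.2 :=
  ⟨Unit, inferInstance, fun _ => f, fun _ => hf, fun _ => ⟨C, hC⟩, fun p => by simp⟩

theorem const {c : ℝ} (hc : 0 ≤ c) : IsFiniteRankGram fun _ : X × X => c := by
  have h := mul_self (X := X) (f := fun _ => √c) measurable_const (C := |√c|) fun _ => le_rfl
  simpa only [Real.mul_self_sqrt hc] using h

theorem add (h : IsFiniteRankGram K) (h' : IsFiniteRankGram K') :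
    IsFiniteRankGram fun p => K p + K' p := by
  obtain ⟨ι, _, f, hm, hb, hK⟩ := h
  obtain ⟨ι', _, f', hm', hb', hK'⟩ := h'
  refine ⟨ι ⊕ ι', inferInstance, Sum.elim f f', ?_, ?_, fun p => ?_⟩
  · rintro (i | i)
    exacts [hm i, hm' i]
  · rintro (i | i)
    exacts [hb i, hb' i]
  · simp [Fintype.sum_sum_type, hK, hK']

/-- Schur product: the features of the product are the products `f i * f' j`. -/
theorem mul (h : IsFiniteRankGram K) (h' : IsFiniteRankGram K') :
    IsFiniteRankGram fun p => K p * K' p := by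
  obtain ⟨ι, _, f, hm, hb, hK⟩ := h
  obtain ⟨ι', _, f', hm', hb', hK'⟩ := h'
  refine ⟨ι × ι', inferInstance, fun i x => f i.1 x * f' i.2 x,
    fun i => (hm i.1).mul (hm' i.2), fun i => ?_, fun p => ?_⟩
  · obtain ⟨C, hC⟩ := hb i.1
    obtain ⟨C', hC'⟩ := hb' i.2
    refine ⟨C * C', fun x => ?_⟩
    rw [abs_mul]
    exact mul_le_mul (hC x) (hC' x) (abs_nonneg _) ((abs_nonneg _).trans (hC x))
  · simp only [hK, hK']
    rw [Finset.sum_mul_sum, Fintype.sum_prod_type]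
    refine Finset.sum_congr rfl fun i _ => Finset.sum_congr rfl fun j _ => ?_
    ring

theorem pow (h : IsFiniteRankGram K) (m : ℕ) : IsFiniteRankGram fun p => K p ^ m := by
  induction m with
  | zero => simpa using const (X := X) zero_le_one
  | succ m ih => simpa only [pow_succ] using ih.mul h

theorem div_const (h : IsFiniteRankGram K) {c : ℝ} (hc : 0 ≤ c) :
    IsFiniteRankGram fun p => K p / c := by
  simpa only [div_eq_mul_inv] using h.mul (const (inv_nonneg.2 hc))

theorem finsetSum {ι : Type*} (s : Finset ι) {F : ι → X × X → ℝ}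
    (h : ∀ i ∈ s, IsFiniteRankGram (F i)) : IsFiniteRankGram fun p => ∑ i ∈ s, F i p := by
  classical
  induction s using Finset.induction_on with
  | empty => simpa using const (X := X) le_rfl
  | insert a s ha ih =>
    simp only [Finset.sum_insert ha]
    exact (h a (Finset.mem_insert_self a s)).add
      (ih fun i hi => h i (Finset.mem_insert_of_mem hi))

theorem measurable (h : IsFiniteRankGram K) : Measurable K := by
  obtain ⟨ι, _, f, hm, -, hK⟩ := h
  rw [funext hK]
  exact Finset.measurable_sum _ fun i _ =>
    ((hm i).comp measurable_fst).mul ((hm i).comp measurable_snd)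

theorem kernelIntegrable (h : IsFiniteRankGram K) (μ ν : Measure X) [IsFiniteMeasure μ]
    [IsFiniteMeasure ν] : KernelIntegrable μ ν K := by
  have hmeas := h.measurable
  obtain ⟨ι, _, f, hm, hb, hK⟩ := h
  choose C hC using hb
  refine .of_bound hmeas (C := ∑ i, C i * C i) fun p => ?_
  rw [hK]
  refine (Finset.abs_sum_le_sum_abs _ _).trans (Finset.sum_le_sum fun i _ => ?_)
  rw [abs_mul]
  exact mul_le_mul (hC i _) (hC i _) (abs_nonneg _) ((abs_nonneg _).trans (hC i p.1))

theorem kernelEnergy_nonneg (h : IsFiniteRankGram K) (μ ν : Measure X) [IsFiniteMeasure μ]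
    [IsFiniteMeasure ν] : 0 ≤ kernelEnergy μ ν K := by
  obtain ⟨ι, _, f, hm, hb, hK⟩ := h
  rw [funext hK, kernelEnergy_finsetSum _ fun i _ =>
    (mul_self (hm i) (hb i).choose_spec).kernelIntegrable μ ν]
  refine Finset.sum_nonneg fun i _ => ?_
  rw [kernelEnergy_mul_self]
  positivity

end IsFiniteRankGram

end FiniteRank

/-! ### The signed measure `(μ₁ - μ₂)²` as four product measures -/

section SignedMeasure

variable {X : Type*} [MeasurableSpace X]

/-- Rectangles determine the product of two signed measures, and on them the claim is the expansion
of a product of differences. -/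
theorem diffSq_eq (μ₁ μ₂ : ProbabilityMeasure X) :
    diffSq μ₁ μ₂ =
      ((μ₁ : Measure X).prod (μ₁ : Measure X)).toSignedMeasure -
        ((μ₁ : Measure X).prod (μ₂ : Measure X)).toSignedMeasure -
        ((μ₂ : Measure X).prod (μ₁ : Measure X)).toSignedMeasure +
        ((μ₂ : Measure X).prod (μ₂ : Measure X)).toSignedMeasure := by
  refine VectorMeasure.prod_eq_of_forall_apply_prod fun s t hs ht => ?_
  simp [hs, ht, hs.prod ht, measureReal_prod_prod]
  ring

theorem integrable_toSignedMeasure {Y : Type*} [MeasurableSpace Y] {ρ : Measure Y}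
    [IsFiniteMeasure ρ] {f : Y → ℝ} (hf : Integrable f ρ) : ρ.toSignedMeasure.Integrable f := by
  rwa [VectorMeasure.Integrable, Measure.variation_toSignedMeasure]

theorem integrable_diffSq {μ₁ μ₂ : ProbabilityMeasure X} {K : X × X → ℝ}
    (h : KernelIntegrable (μ₁ : Measure X) (μ₂ : Measure X) K) :
    (diffSq μ₁ μ₂).Integrable K := by
  rw [diffSq_eq]
  exact (((integrable_toSignedMeasure h.1).sub_vectorMeasure
    (integrable_toSignedMeasure h.2)).sub_vectorMeasure
    (integrable_toSignedMeasure h.3)).add_vectorMeasure (integrable_toSignedMeasure h.4)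

theorem integral_diffSq {μ₁ μ₂ : ProbabilityMeasure X} {K : X × X → ℝ}
    (h : KernelIntegrable (μ₁ : Measure X) (μ₂ : Measure X) K) :
    (diffSq μ₁ μ₂).integral K (ContinuousLinearMap.mul ℝ ℝ) =
      kernelEnergy (μ₁ : Measure X) (μ₂ : Measure X) K := by
  have h1 := integrable_toSignedMeasure h.1
  have h2 := integrable_toSignedMeasure h.2
  have h3 := integrable_toSignedMeasure h.3
  have h4 := integrable_toSignedMeasure h.4
  -- Both pairings are multiplication of reals; the flipped scalar action is the form in which
  -- integrals against `toSignedMeasure` become ordinary integrals.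
  have hB : ContinuousLinearMap.mul ℝ ℝ = (ContinuousLinearMap.lsmul ℝ ℝ).flip := by
    ext; simp
  rw [diffSq_eq, hB,
    VectorMeasure.integral_add_vectorMeasure ((h1.sub_vectorMeasure h2).sub_vectorMeasure h3) h4,
    VectorMeasure.integral_sub_vectorMeasure (h1.sub_vectorMeasure h2) h3,
    VectorMeasure.integral_sub_vectorMeasure h1 h2]
  simp only [VectorMeasure.integral_toSignedMeasure, kernelEnergy]

end SignedMeasure

/-! ### Polynomial approximation of `(1 - √(1 - w)) / 2` -/

section CatalanIter

/-- The iteration `z ↦ w / 4 + z ²` from `0`; it is a polynomial in `w` with nonnegative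
coefficients, and tends to the smaller root `(1 - √(1 - w)) / 2` of `z - z ² = w / 4`. -/
noncomputable def catalanIter (w : ℝ) : ℕ → ℝ
  | 0 => 0
  | j + 1 => w / 4 + catalanIter w j ^ 2

variable {w : ℝ}

theorem continuous_catalanIter (j : ℕ) : Continuous fun w => catalanIter w j := by
  induction j with
  | zero => exact continuous_const
  | succ j ih => exact (continuous_id.div_const 4).add (ih.pow 2)

theorem catalanIter_nonneg (h0 : 0 ≤ w) (j : ℕ) : 0 ≤ catalanIter w j := by
  induction j with
  | zero => exact le_rfl
  | succ j ih => rw [catalanIter]; positivity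

/-- The bound is a fixed point of `z ↦ w / 4 + z ^ 2`, which is increasing on `z ≥ 0`. -/
theorem catalanIter_le (h0 : 0 ≤ w) (h1 : w ≤ 1) (j : ℕ) :
    catalanIter w j ≤ (1 - √(1 - w)) / 2 := by
  have hs := Real.sq_sqrt (sub_nonneg.2 h1)
  have hs1 : √(1 - w) ≤ 1 := Real.sqrt_le_one.2 (by linarith)
  induction j with
  | zero => rw [catalanIter]; linarith
  | succ j ih =>
    have := pow_le_pow_left₀ (catalanIter_nonneg h0 j) ih 2
    rw [catalanIter]
    nlinarith

theorem catalanIter_le_half (h0 : 0 ≤ w) (h1 : w ≤ 1) (j : ℕ) : catalanIter w j ≤ 1 / 2 := by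
  have := catalanIter_le h0 h1 j
  have := Real.sqrt_nonneg (1 - w)
  linarith

theorem catalanIter_le_succ (h0 : 0 ≤ w) (j : ℕ) : catalanIter w j ≤ catalanIter w (j + 1) := by
  induction j with
  | zero => exact catalanIter_nonneg h0 1
  | succ j ih =>
    have := pow_le_pow_left₀ (catalanIter_nonneg h0 j) ih 2
    rw [catalanIter, catalanIter.eq_2 w (j + 1)]
    linarith

theorem tendsto_catalanIter (h0 : 0 ≤ w) (h1 : w ≤ 1) :
    Tendsto (catalanIter w) atTop (𝓝 ((1 - √(1 - w)) / 2)) := by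
  have hmono : Monotone (catalanIter w) := monotone_nat_of_le_succ (catalanIter_le_succ h0)
  have hbdd : BddAbove (Set.range (catalanIter w)) :=
    ⟨_, Set.forall_mem_range.2 (catalanIter_le h0 h1)⟩
  have hlim := tendsto_atTop_ciSup hmono hbdd
  set l := ⨆ j, catalanIter w j
  have hle : l ≤ (1 - √(1 - w)) / 2 := ciSup_le (catalanIter_le h0 h1)
  have hfix : l = w / 4 + l ^ 2 :=
    tendsto_nhds_unique ((tendsto_add_atTop_iff_nat 1).2 hlim) ((hlim.pow 2).const_add (w / 4))
  have hs := Real.sq_sqrt (sub_nonneg.2 h1)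
  have hs0 := Real.sqrt_nonneg (1 - w)
  have : l = (1 - √(1 - w)) / 2 := by
    -- The limit is one of the two fixed points. By `hle` it can be the larger one only if the two
    -- coincide.
    have hprod : (l - (1 - √(1 - w)) / 2) * (l - (1 + √(1 - w)) / 2) = 0 := by nlinarith
    rcases mul_eq_zero.1 hprod with h | h <;> linarith
  rwa [this] at hlim

end CatalanIter

/-! ### The series of `-log (1 - x)` and the splitting of `arcosh` -/

section LogSeries

/-- The partial sums of the series of `-log (1 - x)`. -/
noncomputable def logPartialSum (N : ℕ) (x : ℝ) : ℝ :=
  ∑ m ∈ Finset.range N, x ^ (m + 1) / (m + 1)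

theorem continuous_logPartialSum (N : ℕ) : Continuous (logPartialSum N) := by
  unfold logPartialSum
  fun_prop

theorem tendsto_logPartialSum {x : ℝ} (hx : |x| < 1) :
    Tendsto (fun N => logPartialSum N x) atTop (𝓝 (-Real.log (1 - x))) :=
  (Real.hasSum_pow_div_log_of_abs_lt_one hx).tendsto_sum_nat

theorem abs_logPartialSum_le {x : ℝ} (hx : |x| < 1) (N : ℕ) :
    |logPartialSum N x| ≤ -Real.log (1 - |x|) := by
  have hs := Real.hasSum_pow_div_log_of_abs_lt_one (x := |x|) (by rwa [abs_abs])
  refine (Finset.abs_sum_le_sum_abs _ _).trans ?_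
  have : ∀ m : ℕ, |x ^ (m + 1) / ((m : ℝ) + 1)| = |x| ^ (m + 1) / ((m : ℝ) + 1) := fun m => by
    rw [abs_div, abs_pow, abs_of_pos (by positivity : (0 : ℝ) < (m : ℝ) + 1)]
  simp only [this]
  exact sum_le_hasSum _ (fun m _ => by positivity) hs

theorem neg_log_one_sub_le_log_two {x : ℝ} (h : x ≤ 1 / 2) : -Real.log (1 - x) ≤ Real.log 2 := by
  rw [← Real.log_inv]
  refine Real.log_le_log (inv_pos.2 (by linarith)) ?_
  rw [inv_le_comm₀ (by linarith) two_pos]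
  linarith

theorem abs_neg_log_one_sub_le_log_two {x : ℝ} (h0 : 0 ≤ x) (h : x ≤ 1 / 2) :
    |-Real.log (1 - x)| ≤ Real.log 2 := by
  rw [abs_of_nonneg (neg_nonneg.2 (Real.log_nonpos (by linarith) (by linarith)))]
  exact neg_log_one_sub_le_log_two h

theorem abs_logPartialSum_le_log_two {x : ℝ} (h0 : 0 ≤ x) (h : x ≤ 1 / 2) (N : ℕ) :
    |logPartialSum N x| ≤ Real.log 2 := by
  have hx : |x| = x := abs_of_nonneg h0
  refine (abs_logPartialSum_le (by rw [hx]; linarith) N).trans ?_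
  rw [hx]
  exact neg_log_one_sub_le_log_two h

/-- Factor `u` out of `u + √(u ^ 2 - 1)` and write `(1 + s) / 2 = 1 - (1 - s) / 2`. -/
theorem arcosh_eq_log_add {u : ℝ} (hu : 1 ≤ u) :
    Real.arcosh u =
      Real.log u + Real.log 2 - -Real.log (1 - (1 - √(1 - (u⁻¹) ^ 2)) / 2) := by
  have hu0 : 0 < u := by linarith
  have hs : √(u ^ 2 - 1) = u * √(1 - (u⁻¹) ^ 2) := by
    rw [← Real.sqrt_sq hu0.le, ← Real.sqrt_mul (sq_nonneg u), Real.sqrt_sq hu0.le]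
    congr 1
    field_simp
  have hs0 := Real.sqrt_nonneg (1 - (u⁻¹) ^ 2)
  rw [Real.arcosh, hs, sub_neg_eq_add, ← Real.log_mul hu0.ne' two_ne_zero,
    ← Real.log_mul (by positivity) (by linarith)]
  congr 1
  ring

end LogSeries

theorem IsFiniteRankGram.catalanIter {X : Type*} [MeasurableSpace X] {K : X × X → ℝ}
    (hK : IsFiniteRankGram K) (j : ℕ) : IsFiniteRankGram fun p => catalanIter (K p) j := by
  induction j with
  | zero => exact .const le_rfl
  | succ j ih => exact (hK.div_const (by norm_num)).add (ih.pow 2)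

theorem IsFiniteRankGram.logPartialSum {X : Type*} [MeasurableSpace X] {K : X × X → ℝ}
    (hK : IsFiniteRankGram K) (N : ℕ) : IsFiniteRankGram fun p => logPartialSum N (K p) :=
  .finsetSum _ fun m _ => (hK.pow (m + 1)).div_const (by positivity)

/-! ### The Klein model and the decomposition of the distance -/

namespace HyperbolicSpace

variable {n : ℕ}

theorem space_ofSpace (x : EuclideanSpace ℝ (Fin n)) : (ofSpace x).space = x := rfl

theorem time_ofSpace_zero : (ofSpace (0 : EuclideanSpace ℝ (Fin n))).time = 1 := by
  simp [ofSpace]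

theorem lorentz_apex (p : HyperbolicSpace n) : lorentz p (ofSpace 0) = p.time := by
  rw [lorentz, time_ofSpace_zero, space_ofSpace, inner_zero_right, mul_one, sub_zero]

theorem one_le_time (p : HyperbolicSpace n) : 1 ≤ p.time :=
  lorentz_apex p ▸ one_le_lorentz p _

theorem continuous_lorentz_left (q : HyperbolicSpace n) : Continuous fun p => lorentz p q := by
  simp only [← cosh_dist]
  fun_prop

theorem continuous_time : Continuous (time : HyperbolicSpace n → ℝ) := by
  simpa only [lorentz_apex] using continuous_lorentz_left (ofSpace (0 : EuclideanSpace ℝ (Fin n)))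

/-- The topology is that of the hyperbolic metric, so continuity has to come from `lorentz`: pairing
with the point above `v` recovers `⟪p.space, v⟫`. -/
theorem continuous_space : Continuous (space : HyperbolicSpace n → EuclideanSpace ℝ (Fin n)) := by
  have hinner : ∀ v : EuclideanSpace ℝ (Fin n), Continuous fun p : HyperbolicSpace n =>
      inner ℝ p.space v := fun v => by
    have : (fun p : HyperbolicSpace n => inner ℝ p.space v) =
        fun p => p.time * (ofSpace v).time - lorentz p (ofSpace v) := by
      funext p
      rw [lorentz, space_ofSpace]
      ring
    rw [this]
    exact (continuous_time.mul_const _).sub (continuous_lorentz_left _)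
  refine (PiLp.continuous_toLp 2 _).comp (f := fun p : HyperbolicSpace n => p.space.ofLp)
    (continuous_pi fun i => ?_)
  simpa [EuclideanSpace.inner_single_right] using hinner (EuclideanSpace.single i 1)

/-- The point of the open unit ball that represents `p` in the Klein model. -/
noncomputable def klein (p : HyperbolicSpace n) : EuclideanSpace ℝ (Fin n) := p.time⁻¹ • p.space

theorem continuous_klein : Continuous (klein (n := n)) :=
  (continuous_time.inv₀ fun p => p.time_pos.ne').smul continuous_space

theorem measurable_klein : Measurable (klein (n := n)) := continuous_klein.measurable

theorem norm_klein_le_one (p : HyperbolicSpace n) : ‖klein p‖ ≤ 1 := by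
  have h := p.time_sq_sub
  have : ‖p.space‖ ≤ p.time :=
    (le_abs_self _).trans (abs_le_of_sq_le_sq (by linarith) p.time_pos.le)
  rw [klein, norm_smul, norm_inv, Real.norm_of_nonneg p.time_pos.le, inv_mul_le_one₀ p.time_pos]
  exact this

theorem one_sub_norm_klein_sq (p : HyperbolicSpace n) : 1 - ‖klein p‖ ^ 2 = (p.time⁻¹) ^ 2 := by
  have h := p.time_sq_sub
  have h0 := p.time_pos.ne'
  rw [klein, norm_smul, norm_inv, Real.norm_of_nonneg p.time_pos.le]
  field_simp
  linarith

/-- The inverse of the Klein model. -/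
noncomputable def ofKlein (y : EuclideanSpace ℝ (Fin n)) : HyperbolicSpace n :=
  ofSpace ((√(1 - ‖y‖ ^ 2))⁻¹ • y)

/-- Off the open ball the factor `(√(1 - ‖y‖ ^ 2))⁻¹` takes the default value `0`; measurability
survives the jump at the sphere. -/
theorem measurable_ofKlein : Measurable (ofKlein (n := n)) := by
  have h : Measurable fun y : EuclideanSpace ℝ (Fin n) => (√(1 - ‖y‖ ^ 2))⁻¹ := by fun_prop
  exact continuous_ofSpace.measurable.comp (h.smul measurable_id)

theorem ofKlein_klein (p : HyperbolicSpace n) : ofKlein (klein p) = p := by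
  obtain ⟨x, rfl⟩ := surjective_ofSpace p
  rw [ofKlein, one_sub_norm_klein_sq, Real.sqrt_sq (inv_nonneg.2 (time_pos _).le), inv_inv, klein,
    smul_smul, mul_inv_cancel₀ (time_pos _).ne', one_smul, space_ofSpace]

/-- The Euclidean inner product in the Klein model, as a kernel. -/
noncomputable def kleinInner (p : HyperbolicSpace n × HyperbolicSpace n) : ℝ :=
  inner ℝ (klein p.1) (klein p.2)

theorem kleinInner_eq_sum (p : HyperbolicSpace n × HyperbolicSpace n) :
    kleinInner p = ∑ i, klein p.1 i * klein p.2 i := by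
  simp [kleinInner, PiLp.inner_apply, mul_comm]

theorem abs_klein_apply_le_one (i : Fin n) (p : HyperbolicSpace n) : |klein p i| ≤ 1 :=
  (PiLp.norm_apply_le (klein p) i).trans (norm_klein_le_one p)

theorem measurable_klein_apply (i : Fin n) : Measurable fun p : HyperbolicSpace n => klein p i :=
  ((EuclideanSpace.proj (𝕜 := ℝ) i).continuous.comp continuous_klein).measurable

theorem isFiniteRankGram_kleinInner : IsFiniteRankGram (kleinInner (n := n)) :=
  ⟨Fin n, inferInstance, fun i p => klein p i, measurable_klein_apply,
    fun i => ⟨1, abs_klein_apply_le_one i⟩, kleinInner_eq_sum⟩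

theorem lorentz_eq_mul (p q : HyperbolicSpace n) :
    lorentz p q = p.time * q.time * (1 - kleinInner (p, q)) := by
  have hp := p.time_pos.ne'
  have hq := q.time_pos.ne'
  rw [lorentz, kleinInner, klein, klein, real_inner_smul_left, real_inner_smul_right]
  field_simp

/-- The reflection of hyperbolic space in the apex `(1, 0)`. -/
noncomputable def reflect (p : HyperbolicSpace n) : HyperbolicSpace n :=
  ⟨p.time, -p.space, p.time_pos, by rw [norm_neg]; exact p.time_sq_sub⟩

theorem kleinInner_reflect (p q : HyperbolicSpace n) :
    kleinInner (reflect p, q) = -kleinInner (p, q) := by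
  simp [kleinInner, klein, reflect]

/-- Reflecting one point in the apex changes the sign of the inner product, so `one_le_lorentz`
gives both signs. The absolute value is what dominates the power series below. -/
theorem one_le_time_mul_one_sub_abs (p q : HyperbolicSpace n) :
    1 ≤ p.time * q.time * (1 - |kleinInner (p, q)|) := by
  rcases abs_cases (kleinInner (p, q)) with h | h
  · rw [h.1, ← lorentz_eq_mul]
    exact one_le_lorentz p q
  · rw [h.1, ← kleinInner_reflect, show p.time = (reflect p).time from rfl, ← lorentz_eq_mul]
    exact one_le_lorentz _ q

theorem abs_kleinInner_lt_one (p q : HyperbolicSpace n) : |kleinInner (p, q)| < 1 := by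
  have h := one_le_time_mul_one_sub_abs p q
  have := mul_pos p.time_pos q.time_pos
  have := pos_of_mul_pos_right (zero_lt_one.trans_le h) this.le
  linarith

theorem neg_log_one_sub_abs_le (p q : HyperbolicSpace n) :
    -Real.log (1 - |kleinInner (p, q)|) ≤ Real.log p.time + Real.log q.time := by
  have h := Real.log_le_log one_pos (one_le_time_mul_one_sub_abs p q)
  have := abs_kleinInner_lt_one p q
  rw [Real.log_one, Real.log_mul (mul_pos p.time_pos q.time_pos).ne' (by linarith),
    Real.log_mul p.time_pos.ne' q.time_pos.ne'] at h
  linarith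

/-- The partial sums of the expansion of `(cosh d)⁻¹` as a geometric series in the Klein model. -/
noncomputable def sechPartialSum (M : ℕ) (p : HyperbolicSpace n × HyperbolicSpace n) : ℝ :=
  p.1.time⁻¹ * p.2.time⁻¹ * ∑ m ∈ Finset.range M, kleinInner p ^ m

theorem isFiniteRankGram_sechPartialSum (M : ℕ) :
    IsFiniteRankGram (sechPartialSum (n := n) M) := by
  refine (IsFiniteRankGram.mul_self (f := fun p : HyperbolicSpace n => p.time⁻¹) (C := 1)
    continuous_time.measurable.inv fun p => ?_).mul
    (.finsetSum _ fun m _ => isFiniteRankGram_kleinInner.pow m)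
  rw [abs_of_pos (inv_pos.2 p.time_pos)]
  exact inv_le_one_of_one_le₀ (one_le_time p)

theorem tendsto_sechPartialSum (p : HyperbolicSpace n × HyperbolicSpace n) :
    Tendsto (fun M => sechPartialSum M p) atTop (𝓝 (lorentz p.1 p.2)⁻¹) := by
  rw [lorentz_eq_mul, mul_inv, mul_inv]
  exact (hasSum_geometric_of_abs_lt_one (abs_kleinInner_lt_one p.1 p.2)).tendsto_sum_nat.const_mul _

theorem abs_sechPartialSum_le_one (M : ℕ) (p : HyperbolicSpace n × HyperbolicSpace n) :
    |sechPartialSum M p| ≤ 1 := by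
  have hx := abs_kleinInner_lt_one p.1 p.2
  have h := one_le_time_mul_one_sub_abs p.1 p.2
  have h1 : |∑ m ∈ Finset.range M, kleinInner p ^ m| ≤ (1 - |kleinInner p|)⁻¹ := by
    refine (Finset.abs_sum_le_sum_abs _ _).trans ?_
    simp only [abs_pow]
    exact sum_le_hasSum _ (fun m _ => by positivity)
      (hasSum_geometric_of_lt_one (abs_nonneg _) hx)
  have ht : 0 < p.1.time * p.2.time := mul_pos p.1.time_pos p.2.time_pos
  rw [sechPartialSum, ← mul_inv, abs_mul, abs_of_pos (inv_pos.2 ht)]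
  calc _ ≤ (p.1.time * p.2.time)⁻¹ * (1 - |kleinInner p|)⁻¹ := by gcongr
    _ = (p.1.time * p.2.time * (1 - |kleinInner (p.1, p.2)|))⁻¹ := by rw [← mul_inv]
    _ ≤ 1 := inv_le_one_of_one_le₀ h

/-- The part `-log (1 - ⟪b, b'⟫)` of the distance, in the Klein model. -/
noncomputable def logKernel (p : HyperbolicSpace n × HyperbolicSpace n) : ℝ :=
  -Real.log (1 - kleinInner p)

/-- The bounded part of the distance, an increasing function of `(cosh d)⁻²`. -/
noncomputable def boundedKernel (p : HyperbolicSpace n × HyperbolicSpace n) : ℝ :=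
  -Real.log (1 - (1 - √(1 - ((lorentz p.1 p.2)⁻¹) ^ 2)) / 2)

/-- The constant `log 2` is shared equally to give the first part the form `g p.1 + g p.2`. -/
theorem dist_eq_sub_sub (p : HyperbolicSpace n × HyperbolicSpace n) :
    dist p.1 p.2 = (Real.log p.1.time + Real.log 2 / 2) + (Real.log p.2.time + Real.log 2 / 2) -
      logKernel p - boundedKernel p := by
  have := abs_lt.1 (abs_kleinInner_lt_one p.1 p.2)
  rw [dist_def, arcosh_eq_log_add (one_le_lorentz _ _), lorentz_eq_mul,
    Real.log_mul (mul_pos p.1.time_pos p.2.time_pos).ne' (by linarith),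
    Real.log_mul p.1.time_pos.ne' p.2.time_pos.ne', boundedKernel, logKernel, lorentz_eq_mul]
  ring

/-- With `d` the distance to the apex, `t = cosh d ≤ exp d`. Hence a finite first moment makes `log
t` integrable. -/
theorem log_time_le_dist (p : HyperbolicSpace n) : Real.log p.time ≤ dist (ofSpace 0) p := by
  rw [dist_comm, Real.log_le_iff_le_exp p.time_pos, ← lorentz_apex p, ← cosh_dist,
    ← Real.cosh_add_sinh]
  exact le_add_of_nonneg_right (Real.sinh_nonneg_iff.2 dist_nonneg)

theorem measurable_logKernel : Measurable (logKernel (n := n)) :=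
  (Real.measurable_log.comp (isFiniteRankGram_kleinInner.measurable.const_sub 1)).neg

theorem measurable_inv_lorentz :
    Measurable fun p : HyperbolicSpace n × HyperbolicSpace n => (lorentz p.1 p.2)⁻¹ := by
  simp only [← cosh_dist]
  have : Continuous fun p : HyperbolicSpace n × HyperbolicSpace n => Real.cosh (dist p.1 p.2) := by
    fun_prop
  exact this.measurable.inv

theorem measurable_boundedKernel : Measurable (boundedKernel (n := n)) := by
  have := measurable_inv_lorentz (n := n)
  unfold boundedKernel
  fun_prop

theorem inv_lorentz_sq_mem (p q : HyperbolicSpace n) :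
    0 ≤ ((lorentz p q)⁻¹) ^ 2 ∧ ((lorentz p q)⁻¹) ^ 2 ≤ 1 := by
  have h := one_le_lorentz p q
  have h0 : 0 ≤ (lorentz p q)⁻¹ := inv_nonneg.2 (by linarith)
  exact ⟨sq_nonneg _, pow_le_one₀ h0 (inv_le_one_of_one_le₀ h)⟩

theorem abs_boundedKernel_le (p : HyperbolicSpace n × HyperbolicSpace n) :
    |boundedKernel p| ≤ Real.log 2 := by
  have h := inv_lorentz_sq_mem p.1 p.2
  have h0 := Real.sqrt_nonneg (1 - ((lorentz p.1 p.2)⁻¹) ^ 2)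
  have h1 : √(1 - ((lorentz p.1 p.2)⁻¹) ^ 2) ≤ 1 := Real.sqrt_le_one.2 (by linarith)
  exact abs_neg_log_one_sub_le_log_two (by linarith) (by linarith)

/-! ### Nonpositivity of the energy of the distance -/

section Energy

variable {μ ν : Measure (HyperbolicSpace n)} [IsFiniteMeasure μ] [IsFiniteMeasure ν]

/-- Three nested limits, from the inside: `M → ∞` in the geometric series of `(cosh d)⁻¹`, `N → ∞`
in the logarithm, `j → ∞` in the iteration. Before the limits the kernel is a finite-rank Gram
kernel. The iterates stay in `[0, 1/2]`, so `log 2` dominates at every stage. -/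
theorem kernelEnergy_boundedKernel_nonneg : 0 ≤ kernelEnergy μ ν boundedKernel := by
  have hm := (measurable_inv_lorentz (n := n)).pow_const 2
  have hw := fun p : HyperbolicSpace n × HyperbolicSpace n => inv_lorentz_sq_mem p.1 p.2
  refine kernelEnergy_nonneg_of_tendsto (C := Real.log 2)
    (F := fun j p => -Real.log (1 - catalanIter (((lorentz p.1 p.2)⁻¹) ^ 2) j))
    (fun j => ?_) (fun j p => ?_) (fun j => ?_) (fun p => ?_)
  · exact (Real.measurable_log.comp
      (((continuous_catalanIter j).measurable.comp hm).const_sub 1)).neg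
  · exact abs_neg_log_one_sub_le_log_two (catalanIter_nonneg (hw p).1 j)
      (catalanIter_le_half (hw p).1 (hw p).2 j)
  · refine kernelEnergy_nonneg_of_tendsto (C := Real.log 2)
      (F := fun N p => logPartialSum N (catalanIter (((lorentz p.1 p.2)⁻¹) ^ 2) j))
      (fun N => ?_) (fun N p => ?_) (fun N => ?_) (fun p => ?_)
    · exact (continuous_logPartialSum N).measurable.comp
        ((continuous_catalanIter j).measurable.comp hm)
    · exact abs_logPartialSum_le_log_two (catalanIter_nonneg (hw p).1 j)
        (catalanIter_le_half (hw p).1 (hw p).2 j) N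
    · have hgram := fun M => IsFiniteRankGram.logPartialSum (IsFiniteRankGram.catalanIter
        ((isFiniteRankGram_sechPartialSum (n := n) M).pow 2) j) N
      refine kernelEnergy_nonneg_of_tendsto (C := Real.log 2)
        (F := fun M p => logPartialSum N (catalanIter (sechPartialSum M p ^ 2) j))
        (fun M => (hgram M).measurable) (fun M p => ?_)
        (fun M => (hgram M).kernelEnergy_nonneg μ ν) (fun p => ?_)
      · have h0 := sq_nonneg (sechPartialSum M p)
        have h1 := (sq_le_one_iff_abs_le_one _).2 (abs_sechPartialSum_le_one M p)
        exact abs_logPartialSum_le_log_two (catalanIter_nonneg h0 j)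
          (catalanIter_le_half h0 h1 j) N
      · exact (((continuous_logPartialSum N).comp (continuous_catalanIter j)).tendsto _).comp
          ((tendsto_sechPartialSum p).pow 2)
    · have h0 := catalanIter_nonneg (hw p).1 j
      have h1 := catalanIter_le_half (hw p).1 (hw p).2 j
      exact tendsto_logPartialSum (by rw [abs_of_nonneg h0]; linarith)
  · have h0 := Real.sqrt_nonneg (1 - ((lorentz p.1 p.2)⁻¹) ^ 2)
    exact (((tendsto_catalanIter (hw p).1 (hw p).2).const_sub 1).log (by linarith)).neg

theorem kernelIntegrable_logKernel
    (hμ : Integrable (fun p => Real.log p.time) μ)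
    (hν : Integrable (fun p => Real.log p.time) ν) : KernelIntegrable μ ν logKernel := by
  refine (kernelIntegrable_fst_add_snd hμ hν).mono measurable_logKernel fun p => ?_
  refine le_trans ?_ (neg_log_one_sub_abs_le p.1 p.2)
  -- The bound on the partial sums passes to their limit `logKernel`.
  exact le_of_tendsto' (tendsto_logPartialSum (abs_kleinInner_lt_one p.1 p.2)).abs
    (abs_logPartialSum_le (abs_kleinInner_lt_one p.1 p.2))

/-- Every term of the series has nonnegative energy, so a single one is a lower bound. Keeping an
arbitrary term is what makes the equality case accessible. -/
theorem kernelEnergy_pow_div_le_logKernel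
    (hμ : Integrable (fun p => Real.log p.time) μ)
    (hν : Integrable (fun p => Real.log p.time) ν) (j : ℕ) :
    kernelEnergy μ ν (fun p => kleinInner p ^ (j + 1)) / (j + 1) ≤ kernelEnergy μ ν logKernel := by
  have hterm : ∀ m : ℕ, IsFiniteRankGram fun p : HyperbolicSpace n × HyperbolicSpace n =>
      kleinInner p ^ (m + 1) / (m + 1) := fun m =>
    (isFiniteRankGram_kleinInner.pow (m + 1)).div_const (by positivity)
  refine ge_of_tendsto (tendsto_kernelEnergy (F := fun N p => logPartialSum N (kleinInner p))
    (fun N => (IsFiniteRankGram.logPartialSum isFiniteRankGram_kleinInner N).measurable)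
    (kernelIntegrable_fst_add_snd hμ hν)
    (fun N p => (abs_logPartialSum_le (abs_kleinInner_lt_one p.1 p.2) N).trans
      (neg_log_one_sub_abs_le p.1 p.2))
    fun p => tendsto_logPartialSum (abs_kleinInner_lt_one p.1 p.2)) ?_
  filter_upwards [eventually_gt_atTop j] with N hN
  simp only [logPartialSum]
  rw [kernelEnergy_finsetSum _ fun m _ => (hterm m).kernelIntegrable μ ν,
    ← kernelEnergy_div_const]
  exact Finset.single_le_sum (f := fun m : ℕ => kernelEnergy μ ν fun p =>
    kleinInner p ^ (m + 1) / (m + 1)) (fun m _ => (hterm m).kernelEnergy_nonneg μ ν)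
    (Finset.mem_range.2 hN)

theorem kernelIntegrable_dist
    (hμ : Integrable (fun p => Real.log p.time) μ)
    (hν : Integrable (fun p => Real.log p.time) ν) :
    KernelIntegrable μ ν fun p => dist p.1 p.2 := by
  simp only [dist_eq_sub_sub]
  exact ((kernelIntegrable_fst_add_snd (hμ.add (integrable_const _))
    (hν.add (integrable_const _))).sub (kernelIntegrable_logKernel hμ hν)).sub
    (.of_bound measurable_boundedKernel abs_boundedKernel_le)

theorem kernelEnergy_dist
    (hμ : Integrable (fun p => Real.log p.time) μ)
    (hν : Integrable (fun p => Real.log p.time) ν)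
    (hmass : μ.real Set.univ = ν.real Set.univ) :
    kernelEnergy μ ν (fun p => dist p.1 p.2) =
      -kernelEnergy μ ν logKernel - kernelEnergy μ ν boundedKernel := by
  have hμ' : Integrable (fun p => Real.log p.time + Real.log 2 / 2) μ := hμ.add (integrable_const _)
  have hν' : Integrable (fun p => Real.log p.time + Real.log 2 / 2) ν := hν.add (integrable_const _)
  have h := kernelIntegrable_fst_add_snd hμ' hν'
  have h0 := kernelEnergy_fst_add_snd hμ' hν' hmass
  have hG := kernelIntegrable_logKernel hμ hν
  simp only [dist_eq_sub_sub]
  rw [kernelEnergy_sub (h.sub hG) (.of_bound measurable_boundedKernel abs_boundedKernel_le),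
    kernelEnergy_sub h hG, h0, zero_sub]

theorem kernelEnergy_dist_le
    (hμ : Integrable (fun p => Real.log p.time) μ)
    (hν : Integrable (fun p => Real.log p.time) ν)
    (hmass : μ.real Set.univ = ν.real Set.univ) (j : ℕ) :
    kernelEnergy μ ν (fun p => dist p.1 p.2) ≤
      -(kernelEnergy μ ν (fun p => kleinInner p ^ (j + 1)) / (j + 1)) := by
  rw [kernelEnergy_dist hμ hν hmass]
  linarith [kernelEnergy_pow_div_le_logKernel hμ hν j,
    kernelEnergy_boundedKernel_nonneg (μ := μ) (ν := ν)]

theorem kernelEnergy_dist_nonpos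
    (hμ : Integrable (fun p => Real.log p.time) μ)
    (hν : Integrable (fun p => Real.log p.time) ν)
    (hmass : μ.real Set.univ = ν.real Set.univ) :
    kernelEnergy μ ν (fun p => dist p.1 p.2) ≤ 0 :=
  (kernelEnergy_dist_le hμ hν hmass 0).trans <| neg_nonpos.2 <|
    div_nonneg ((isFiniteRankGram_kleinInner.pow _).kernelEnergy_nonneg μ ν) (by positivity)

end Energy

end HyperbolicSpace

/-! ### Moments of a bounded function determine its characteristic function -/

section Moments

variable {X : Type*} [MeasurableSpace X]

theorem hasSum_integral_cexp (μ : Measure X) [IsFiniteMeasure μ] {g : X → ℝ}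
    (hg : Measurable g) {C : ℝ} (hC : ∀ x, |g x| ≤ C) :
    HasSum (fun j : ℕ => Complex.I ^ j / (j.factorial : ℂ) * ((∫ x, g x ^ j ∂μ : ℝ) : ℂ))
      (∫ x, Complex.exp (g x * Complex.I) ∂μ) := by
  have hterm : ∀ (j : ℕ) (x : X), ‖((g x : ℂ) * Complex.I) ^ j / (j.factorial : ℂ)‖ ≤
      C ^ j / j.factorial := fun j x => by
    simp only [norm_div, norm_pow, norm_mul, Complex.norm_real, Complex.norm_I, mul_one,
      Complex.norm_natCast, Real.norm_eq_abs]
    gcongr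
    exact hC x
  have key := hasSum_integral_of_dominated_convergence (μ := μ)
    (F := fun (j : ℕ) x => ((g x : ℂ) * Complex.I) ^ j / (j.factorial : ℂ))
    (f := fun x => Complex.exp (g x * Complex.I)) (fun j _ => C ^ j / j.factorial)
    (fun j => Measurable.aestronglyMeasurable (by fun_prop)) (fun j => .of_forall (hterm j))
    (.of_forall fun _ => Real.summable_pow_div_factorial C) (integrable_const _)
    (.of_forall fun x => by
      rw [Complex.exp_eq_exp_ℂ]
      exact NormedSpace.expSeries_div_hasSum_exp _)
  have hj : ∀ j : ℕ, ∫ x, ((g x : ℂ) * Complex.I) ^ j / (j.factorial : ℂ) ∂μ =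
      Complex.I ^ j / (j.factorial : ℂ) * ((∫ x, g x ^ j ∂μ : ℝ) : ℂ) := fun j => by
    rw [← integral_complex_ofReal, ← integral_const_mul]
    refine integral_congr_ae (.of_forall fun x => ?_)
    push_cast
    ring
  simpa only [hj] using key

end Moments

/-! ### The equality case and negative type -/

namespace HyperbolicSpace

variable {n : ℕ} {μ ν : Measure (HyperbolicSpace n)} [IsFiniteMeasure μ] [IsFiniteMeasure ν]

/-- The features are the coordinates of the tensor power `b ^ ⊗j`, indexed by words `α`, so no
multinomial coefficients appear. -/
theorem kleinInner_pow_eq_sum (j : ℕ) (p : HyperbolicSpace n × HyperbolicSpace n) :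
    kleinInner p ^ j =
      ∑ α : Fin j → Fin n, (∏ k, klein p.1 (α k)) * ∏ k, klein p.2 (α k) := by
  rw [kleinInner_eq_sum, Fintype.sum_pow]
  simp only [Finset.prod_mul_distrib]

theorem measurable_prod_klein {j : ℕ} (α : Fin j → Fin n) :
    Measurable fun p : HyperbolicSpace n => ∏ k, klein p (α k) :=
  Finset.measurable_prod _ fun k _ => measurable_klein_apply (α k)

theorem abs_prod_klein_le_one {j : ℕ} (α : Fin j → Fin n) (p : HyperbolicSpace n) :
    |∏ k, klein p (α k)| ≤ 1 := by
  rw [Finset.abs_prod]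
  exact Finset.prod_le_one (fun _ _ => abs_nonneg _) fun k _ => abs_klein_apply_le_one (α k) p

theorem kernelEnergy_kleinInner_pow (j : ℕ) :
    kernelEnergy μ ν (fun p => kleinInner p ^ j) = ∑ α : Fin j → Fin n,
      (∫ p, ∏ k, klein p (α k) ∂μ - ∫ p, ∏ k, klein p (α k) ∂ν) ^ 2 := by
  simp only [kleinInner_pow_eq_sum]
  rw [kernelEnergy_finsetSum _ fun α _ => (IsFiniteRankGram.mul_self (measurable_prod_klein α)
    (abs_prod_klein_le_one α)).kernelIntegrable μ ν]
  exact Finset.sum_congr rfl fun α _ =>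
    kernelEnergy_mul_self fun p : HyperbolicSpace n => ∏ k, klein p (α k)

/-- Coordinate moments give those of every `⟪b, ξ⟫`, hence the characteristic function of the law of
`b`; the measurable left inverse `ofKlein` carries that law back. -/
theorem eq_of_integral_prod_klein_eq
    (h : ∀ (j : ℕ) (α : Fin j → Fin n),
      ∫ p, ∏ k, klein p (α k) ∂μ = ∫ p, ∏ k, klein p (α k) ∂ν) : μ = ν := by
  have hmoment : ∀ (ξ : EuclideanSpace ℝ (Fin n)) (j : ℕ),
      ∫ p, inner ℝ (klein p) ξ ^ j ∂μ = ∫ p, inner ℝ (klein p) ξ ^ j ∂ν := fun ξ j => by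
    have hexp : ∀ p : HyperbolicSpace n, inner ℝ (klein p) ξ ^ j =
        ∑ α : Fin j → Fin n, (∏ k, ξ (α k)) * ∏ k, klein p (α k) := fun p => by
      rw [PiLp.inner_apply, Fintype.sum_pow]
      simp [Finset.prod_mul_distrib]
    have hint : ∀ (ρ : Measure (HyperbolicSpace n)) [IsFiniteMeasure ρ] (α : Fin j → Fin n),
        Integrable (fun p => (∏ k, ξ (α k)) * ∏ k, klein p (α k)) ρ := fun ρ _ α =>
      (Integrable.of_bound (measurable_prod_klein α).aestronglyMeasurable 1
        (.of_forall (abs_prod_klein_le_one α))).const_mul _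
    simp only [hexp]
    rw [integral_finsetSum _ fun α _ => hint μ α, integral_finsetSum _ fun α _ => hint ν α]
    simp only [integral_const_mul, h]
  have hmap : μ.map klein = ν.map klein := by
    refine Measure.ext_of_charFun (funext fun ξ => ?_)
    have hmeas : Measurable fun p : HyperbolicSpace n => inner ℝ (klein p) ξ :=
      (continuous_klein.inner continuous_const).measurable
    have hbound : ∀ p : HyperbolicSpace n, |inner ℝ (klein p) ξ| ≤ ‖ξ‖ := fun p =>
      (abs_real_inner_le_norm _ _).trans
        (mul_le_of_le_one_left (norm_nonneg _) (norm_klein_le_one p))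
    have hexp : ∀ ρ : Measure (HyperbolicSpace n), charFun (ρ.map klein) ξ =
        ∫ p, Complex.exp ((inner ℝ (klein p) ξ : ℝ) * Complex.I) ∂ρ := fun ρ => by
      rw [charFun_apply, integral_map measurable_klein.aemeasurable]
      exact Measurable.aestronglyMeasurable (by fun_prop)
    rw [hexp, hexp]
    have h1 := hasSum_integral_cexp μ hmeas hbound
    simp only [hmoment] at h1
    exact h1.unique (hasSum_integral_cexp ν hmeas hbound)
  have hinv : ∀ ρ : Measure (HyperbolicSpace n), (ρ.map klein).map ofKlein = ρ := fun ρ => by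
    rw [Measure.map_map measurable_ofKlein measurable_klein,
      show ofKlein ∘ klein = (id : HyperbolicSpace n → _) from funext ofKlein_klein,
      Measure.map_id]
  rw [← hinv μ, hmap, hinv]

theorem eq_of_kernelEnergy_dist_eq_zero
    (hμ : Integrable (fun p => Real.log p.time) μ)
    (hν : Integrable (fun p => Real.log p.time) ν)
    (hmass : μ.real Set.univ = ν.real Set.univ)
    (h : kernelEnergy μ ν (fun p => dist p.1 p.2) = 0) : μ = ν := by
  refine eq_of_integral_prod_klein_eq fun j α => ?_
  cases j with
  -- The logarithmic series has no term of degree zero; equality of masses supplies this moment.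
  | zero => simpa using hmass
  | succ j =>
    have hle := kernelEnergy_dist_le hμ hν hmass j
    rw [h, le_neg, neg_zero, div_le_iff₀ (by positivity), zero_mul,
      kernelEnergy_kleinInner_pow] at hle
    have hzero := (Finset.sum_eq_zero_iff_of_nonneg fun β _ => sq_nonneg _).1
      (hle.antisymm (Finset.sum_nonneg fun β _ => sq_nonneg _)) α (Finset.mem_univ α)
    exact sub_eq_zero.1 (pow_eq_zero_iff two_ne_zero |>.1 hzero)

theorem integrable_log_time {o : HyperbolicSpace n} (h : Integrable (fun p => dist o p) μ) :
    Integrable (fun p => Real.log p.time) μ := by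
  refine Integrable.mono' ((integrable_const (dist (ofSpace 0) o)).add h)
    (Real.measurable_log.comp continuous_time.measurable).aestronglyMeasurable
    (.of_forall fun p => ?_)
  rw [Real.norm_of_nonneg (Real.log_nonneg (one_le_time p))]
  exact (log_time_le_dist p).trans (dist_triangle _ o p)

/-- The energy inequality for the sums of Dirac masses at the two families: both have mass `m`, so
no normalisation is needed. -/
theorem hasNegativeType : HasNegativeType (HyperbolicSpace n) := by
  intro m _ x x'
  have hint : ∀ (y : Fin m → HyperbolicSpace n) (f : HyperbolicSpace n → ℝ),
      Integrable f (∑ i, Measure.dirac (y i)) := fun y f =>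
    integrable_finsetSum_measure.2 fun i _ => integrable_dirac (by finiteness)
  have hsum : ∀ (y : Fin m → HyperbolicSpace n) (f : HyperbolicSpace n → ℝ),
      ∫ p, f p ∂(∑ i, Measure.dirac (y i)) = ∑ i, f (y i) := fun y f => by
    rw [integral_finsetSum_measure fun i _ => integrable_dirac (by finiteness)]
    simp only [integral_dirac]
  have hmass : (∑ i, Measure.dirac (x i)).real Set.univ =
      (∑ i, Measure.dirac (x' i)).real Set.univ := by
    simp [measureReal_def]
  have hK := kernelIntegrable_dist (hint x _) (hint x' _)
  have h := kernelEnergy_dist_nonpos (hint x _) (hint x' _) hmass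
  rw [kernelEnergy, integral_prod _ hK.1, integral_prod _ hK.2, integral_prod _ hK.3,
    integral_prod _ hK.4] at h
  simp only [hsum] at h
  have hcomm : ∑ i, ∑ j, dist (x' i) (x j) = ∑ i, ∑ j, dist (x i) (x' j) := by
    rw [Finset.sum_comm]
    simp only [dist_comm]
  simp only [Finset.sum_add_distrib]
  linarith

end HyperbolicSpace

theorem mainTheorem1 (n : ℕ) (hn : 1 ≤ n) :
    HasStrongNegativeType (HyperbolicSpace n) ∧
    (∀ μ₁ ∈ finiteFirstMoment (HyperbolicSpace n), ∀ μ₂ ∈ finiteFirstMoment (HyperbolicSpace n),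
      (diffSq μ₁ μ₂).Integrable
          (fun p : HyperbolicSpace n × HyperbolicSpace n => dist p.1 p.2) ∧
        distIntegral μ₁ μ₂ ≤ 0 ∧
        (distIntegral μ₁ μ₂ = 0 → μ₁ = μ₂)) ∧
    Set.InjOn expectedDist (finiteFirstMoment (HyperbolicSpace n)) := by
  have hlog : ∀ μ ∈ finiteFirstMoment (HyperbolicSpace n),
      Integrable (fun p => Real.log p.time) (μ : Measure (HyperbolicSpace n)) :=
    fun μ ⟨_, ho⟩ => HyperbolicSpace.integrable_log_time ho
  have hmass : ∀ μ ν : ProbabilityMeasure (HyperbolicSpace n),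
      (μ : Measure (HyperbolicSpace n)).real Set.univ =
        (ν : Measure (HyperbolicSpace n)).real Set.univ := fun μ ν => by simp
  have heq : ∀ μ₁ ∈ finiteFirstMoment (HyperbolicSpace n),
      ∀ μ₂ ∈ finiteFirstMoment (HyperbolicSpace n),
      kernelEnergy (μ₁ : Measure (HyperbolicSpace n)) μ₂ (fun p => dist p.1 p.2) = 0 →
        μ₁ = μ₂ := fun μ₁ h₁ μ₂ h₂ h => by
    have := HyperbolicSpace.eq_of_kernelEnergy_dist_eq_zero (hlog μ₁ h₁) (hlog μ₂ h₂)
      (hmass μ₁ μ₂) h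
    exact Subtype.ext this
  have hmain : ∀ μ₁ ∈ finiteFirstMoment (HyperbolicSpace n),
      ∀ μ₂ ∈ finiteFirstMoment (HyperbolicSpace n),
      (diffSq μ₁ μ₂).Integrable
          (fun p : HyperbolicSpace n × HyperbolicSpace n => dist p.1 p.2) ∧
        distIntegral μ₁ μ₂ ≤ 0 ∧ (distIntegral μ₁ μ₂ = 0 → μ₁ = μ₂) := by
    intro μ₁ h₁ μ₂ h₂
    have hK := HyperbolicSpace.kernelIntegrable_dist (hlog μ₁ h₁) (hlog μ₂ h₂)
    have hint : distIntegral μ₁ μ₂ =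
        kernelEnergy (μ₁ : Measure (HyperbolicSpace n)) μ₂ (fun p => dist p.1 p.2) :=
      integral_diffSq hK
    refine ⟨integrable_diffSq hK, ?_, fun h => heq μ₁ h₁ μ₂ h₂ (hint ▸ h)⟩
    rw [hint]
    exact HyperbolicSpace.kernelEnergy_dist_nonpos (hlog μ₁ h₁) (hlog μ₂ h₂) (hmass μ₁ μ₂)
  refine ⟨⟨HyperbolicSpace.hasNegativeType, fun μ₁ h₁ μ₂ h₂ => (hmain μ₁ h₁ μ₂ h₂).2.2⟩, hmain,
    fun μ₁ h₁ μ₂ h₂ h => heq μ₁ h₁ μ₂ h₂ ?_⟩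
  -- By Fubini the energy is the integral of `a_μ₁ - a_μ₂` against `μ₁ - μ₂`, so equal functions
  -- give zero energy.
  have hK := HyperbolicSpace.kernelIntegrable_dist (hlog μ₁ h₁) (hlog μ₂ h₂)
  have hexp : ∀ x, ∫ y, dist x y ∂(μ₁ : Measure (HyperbolicSpace n)) =
      ∫ y, dist x y ∂(μ₂ : Measure (HyperbolicSpace n)) := fun x => congrFun h x
  rw [kernelEnergy, integral_prod _ hK.1, integral_prod _ hK.2, integral_prod _ hK.3,
    integral_prod _ hK.4]
  simp only [hexp]
  ring
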